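/- Let $\mathcal{M}$ be a Markov decision process with finite state space $\mathcal{S}$, finite action space $\mathcal{A}$ and transition probabilities $P(s'\mid s,a)$, and let $s_1\in\mathcal{S}$ be any initial state. Assume that $\mathcal{M}$ is weakly communicating: there is a stationary randomized policy whose induced Markov chain on $\mathcal{S}$ has a single closed irreducible class, and all states outside this class are transient under every stationary policy. For a stationary randomized policy $\pi$, let $$q^{\pi}_{s_1}(s,a)=\lim_{T\to\infty}\frac1T\,\mathbb{E}_\pi\Big[\sum_{t=1}^T \mathbf{1}\{s_t=s,\,a_t=a\}\ \Big|\ s_1\Big]$$ be its occupation measure from $s_1$, where $a_t\sim\pi(\cdot\mid s_t)$ and $s_{t+1}\sim P(\cdot\mid s_t,a_t)$. Let $\mathcal{Q}_{s_1}=\{q^{\pi}_{s_1}:\pi \text{ a stationary randomized policy}\}$, and let $$\mathcal{P}=\Big\{q\in\mathbb{R}^{\mathcal{S}\times\mathcal{A}}:\ q\ge 0,\ \sum_{s,a}q(s,a)=1,\ \sum_a q(s,a)=\sum_{s',a'}q(s',a')P(s\mid s',a')\ \ \forall s\in\mathcal{S}\Big\}$$ be the polytope of stationary state–action measures. Then the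 limits defining $q^{\pi}_{s_1}$ exist for every stationary policy $\pi$, and $$\mathrm{relint}(\mathcal{P})\subseteq\mathcal{Q}_{s_1},\qquad \mathrm{ext}(\mathcal{P})\subseteq\mathcal{Q}_{s_1},\qquad \mathcal{Q}_{s_1}\subseteq\mathcal{P},$$ where $\mathrm{relint}$ and $\mathrm{ext}$ denote the relative interior and the set of extreme points. The set $\mathcal{Q}_{s_1}$ need not be convex: there are a finite weakly communicating Markov decision process and an initial state $s_1$ for which $\mathcal{Q}_{s_1}$ is not convex. -/

import Mathlib

open Filter Topology

/-- The transition data of a finite Markov decision process: `P s a s'` is the probability of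
moving to `s'` when action `a` is taken in state `s`. -/
structure MDP (S A : Type*) [Fintype S] where
  P : S → A → S → ℝ
  P_mem : ∀ s a, P s a ∈ stdSimplex ℝ S

/-- A stationary randomized policy: `prob s a` is the probability `π(a | s)`. -/
structure StationaryPolicy (S A : Type*) [Fintype A] where
  prob : S → A → ℝ
  prob_mem : ∀ s, prob s ∈ stdSimplex ℝ A

namespace MarkovChain

variable {S : Type*} [Fintype S] [DecidableEq S]

/-- `s'` is accessible from `s`: some `n`-step transition probability, `n ≥ 0`, is positive. -/
def Accessible (K : Matrix S S ℝ) (s s' : S) : Prop :=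
  ∃ n : ℕ, 0 < (K ^ n) s s'

/-- No state outside `C` is accessible from a state in `C`. -/
def ClosedSet (K : Matrix S S ℝ) (C : Set S) : Prop :=
  ∀ s ∈ C, ∀ s' ∉ C, ¬ Accessible K s s'

/-- A nonempty closed set without a nonempty closed proper subset. -/
def ClosedIrreducible (K : Matrix S S ℝ) (C : Set S) : Prop :=
  C.Nonempty ∧ ClosedSet K C ∧
    ∀ D : Set S, D ⊆ C → D.Nonempty → ClosedSet K D → D = C

/-- `hitWithin K s n x` is the probability that the chain started at `x` visits `s` at one of
the times `1, …, n` (the starting time `0` does not count). -/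
def hitWithin (K : Matrix S S ℝ) (s : S) : ℕ → S → ℝ
  | 0, _ => 0
  | n + 1, x => K x s + ∑ y ∈ Finset.univ.erase s, K x y * hitWithin K s n y

/-- The probability that the first return time to `s`, starting from `s`, is finite: the limit
of the nondecreasing probabilities of returning within `n` steps. -/
noncomputable def returnProb (K : Matrix S S ℝ) (s : S) : ℝ :=
  ⨆ n : ℕ, hitWithin K s n s

/-- A state is transient if the chain started there returns with probability less than one. -/
def Transient (K : Matrix S S ℝ) (s : S) : Prop :=
  returnProb K s < 1

end MarkovChain

namespace MDP

variable {S A : Type*} [Fintype S] [Fintype A]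

/-- The transition matrix of the Markov chain on the states induced by a stationary policy. -/
def transition (M : MDP S A) (π : StationaryPolicy S A) : Matrix S S ℝ :=
  fun s s' => ∑ a, π.prob s a * M.P s a s'

/-- Some stationary policy induces a chain with a single closed irreducible class, and all
the states outside this class are transient under every stationary policy. -/
def WeaklyCommunicating [DecidableEq S] (M : MDP S A) : Prop :=
  ∃ (π : StationaryPolicy S A) (C : Set S),
    MarkovChain.ClosedIrreducible (M.transition π) C ∧
    (∀ D : Set S, MarkovChain.ClosedIrreducible (M.transition π) D → D = C) ∧
    ∀ s ∉ C, ∀ π' : StationaryPolicy S A, MarkovChain.Transient (M.transition π') s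

/-- The law of the first `n + 1` state-action pairs, started at the state `s₁`: the probability
that the trajectory `(s_1, a_1), …, (s_{n+1}, a_{n+1})` equals `τ`. -/
def trajProb [DecidableEq S] (M : MDP S A) (π : StationaryPolicy S A) (s₁ : S) (n : ℕ)
    (τ : Fin (n + 1) → S × A) : ℝ :=
  (if (τ 0).1 = s₁ then 1 else 0) * π.prob (τ 0).1 (τ 0).2 *
    ∏ t : Fin n, (M.P (τ t.castSucc).1 (τ t.castSucc).2 (τ t.succ).1 *
      π.prob (τ t.succ).1 (τ t.succ).2)

/-- The expected fraction of the first `T = n + 1` time steps that is spent in the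
state-action pair `x`. -/
noncomputable def meanFrequency [DecidableEq S] [DecidableEq A] (M : MDP S A)
    (π : StationaryPolicy S A) (s₁ : S) (n : ℕ) (x : S × A) : ℝ :=
  (1 / ((n : ℝ) + 1)) *
    ∑ τ : Fin (n + 1) → S × A,
      M.trajProb π s₁ n τ * ∑ t : Fin (n + 1), if τ t = x then 1 else 0

/-- The occupation measure of a stationary policy from `s₁`. -/
noncomputable def occupationMeasure [DecidableEq S] [DecidableEq A] (M : MDP S A)
    (π : StationaryPolicy S A) (s₁ : S) : S × A → ℝ :=
  fun x => limUnder atTop (fun n : ℕ => M.meanFrequency π s₁ n x)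

/-- The occupation measures achievable by stationary policies from `s₁`. -/
def achievableOccupationMeasures [DecidableEq S] [DecidableEq A] (M : MDP S A) (s₁ : S) :
    Set (S × A → ℝ) :=
  Set.range fun π : StationaryPolicy S A => M.occupationMeasure π s₁

/-- The polytope of stationary state-action measures. -/
def stationaryPolytope (M : MDP S A) : Set (S × A → ℝ) :=
  {q | ∑ x, q x = 1 ∧ (∀ x, 0 ≤ q x) ∧
    ∀ s, ∑ a, q (s, a) = ∑ x : S × A, q x * M.P x.1 x.2 s}

end MDP

/-! The Cesàro means of the powers of a stochastic matrix converge (`tendsto_cesaro`), and the mean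
frequency of a state-action pair is such a mean times the policy. So the limits exist, and
invariance of the rows of `cesaroLimit` puts occupation measures in the polytope.

Conversely, write a point `q` of the polytope as its state marginal times a policy `π`. The marginal
is invariant under `π`, hence vanishes off the class `C`, whose complement is transient. It remains
to see that the occupation measure of `π` from `s₁` is `q`, although `π` may have several closed
classes. Let `π₀` be the policy that witnesses weak communication.

If `q` is extreme, let `π` follow `π₀` where the marginal vanishes. Then every state of `C` leads to
the support of the marginal, so the occupation measure is carried by the support of `q`, and
extremality forces equality.

If `q` is in the relative interior, its support is the largest possible, so on `C` the policy `π`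
uses every action of `π₀`. Hence `C` communicates under `π`, and the invariant probability on `C` is
unique.

Convexity fails when the action is the next state: a chain cannot split its time evenly between
resting at its start and resting elsewhere without some mass on the move between them. -/

namespace MarkovChain

open Matrix

variable {S : Type*} [Fintype S] [DecidableEq S] {K : Matrix S S ℝ}

/-! ### Cesàro limits of stochastic matrices. -/

/-- The Cesàro mean of the first `n + 1` powers of `K`. -/
noncomputable def cesaro (K : Matrix S S ℝ) (n : ℕ) : Matrix S S ℝ :=
  (1 / ((n : ℝ) + 1)) • ∑ t ∈ Finset.range (n + 1), K ^ t

/-- The geometric sum telescopes; the right side is of order `1 / n`, which makes every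
subsequential limit commute with and absorb `K`. -/
lemma cesaro_mul_sub (K : Matrix S S ℝ) (n : ℕ) :
    cesaro K n * K - cesaro K n = (1 / ((n : ℝ) + 1)) • (K ^ (n + 1) - 1) := by
  rw [cesaro, smul_mul_assoc, ← smul_sub, ← geom_sum_mul, mul_sub, mul_one]

lemma commute_cesaro (K : Matrix S S ℝ) (n : ℕ) : K * cesaro K n = cesaro K n * K := by
  simp only [cesaro, mul_smul_comm, smul_mul_assoc, Finset.mul_sum, Finset.sum_mul,
    ← pow_succ, ← pow_succ']

lemma pow_mem_Icc (hK : K ∈ rowStochastic ℝ S) (n : ℕ) (x y : S) :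
    (K ^ n) x y ∈ Set.Icc (0 : ℝ) 1 :=
  ⟨nonneg_of_mem_rowStochastic (pow_mem hK n), le_one_of_mem_rowStochastic (pow_mem hK n)⟩

lemma cesaro_mem_rowStochastic (hK : K ∈ rowStochastic ℝ S) (n : ℕ) :
    cesaro K n ∈ rowStochastic ℝ S := by
  rw [mem_rowStochastic_iff_sum]
  have hn : (n : ℝ) + 1 ≠ 0 := by positivity
  refine ⟨fun x y => ?_, fun x => ?_⟩
  · simp only [cesaro, Matrix.smul_apply, Matrix.sum_apply, smul_eq_mul]
    exact mul_nonneg (by positivity) (Finset.sum_nonneg fun t _ => (pow_mem_Icc hK t x y).1)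
  · simp only [cesaro, Matrix.smul_apply, Matrix.sum_apply, smul_eq_mul, ← Finset.mul_sum]
    rw [Finset.sum_comm]
    simp only [sum_row_of_mem_rowStochastic (pow_mem hK _) x]
    simp [hn]

lemma tendsto_cesaro_mul_sub (hK : K ∈ rowStochastic ℝ S) :
    Tendsto (fun n => cesaro K n * K - cesaro K n) atTop (𝓝 0) := by
  refine tendsto_pi_nhds.2 fun x => tendsto_pi_nhds.2 fun y => ?_
  refine squeeze_zero_norm (a := fun n : ℕ => 1 / ((n : ℝ) + 1)) (fun n => ?_)
    tendsto_one_div_add_atTop_nhds_zero_nat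
  rw [cesaro_mul_sub, Matrix.smul_apply, smul_eq_mul, norm_mul, Real.norm_of_nonneg (by positivity)]
  refine mul_le_of_le_one_right (by positivity) ?_
  have h1 := pow_mem_Icc hK (n + 1) x y
  have h2 := pow_mem_Icc hK 0 x y
  rw [pow_zero] at h2
  rw [Matrix.sub_apply, Real.norm_eq_abs, abs_le]
  constructor <;> linarith [h1.1, h1.2, h2.1, h2.2]

lemma mul_eq_of_tendsto_subseq (hK : K ∈ rowStochastic ℝ S) {φ : ℕ → ℕ}
    (hφ : Tendsto φ atTop atTop) {L : Matrix S S ℝ}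
    (hL : Tendsto (fun n => cesaro K (φ n)) atTop (𝓝 L)) : L * K = L ∧ K * L = L := by
  have h1 : L * K - L = 0 := tendsto_nhds_unique
    ((hL.mul tendsto_const_nhds).sub hL) ((tendsto_cesaro_mul_sub hK).comp hφ)
  have h2 : K * L - L = 0 := by
    refine tendsto_nhds_unique ((tendsto_const_nhds.mul hL).sub hL) ?_
    simp only [commute_cesaro]
    exact (tendsto_cesaro_mul_sub hK).comp hφ
  exact ⟨sub_eq_zero.1 h1, sub_eq_zero.1 h2⟩

lemma cesaro_mul_eq {L : Matrix S S ℝ} (h : K * L = L) (n : ℕ) : cesaro K n * L = L := by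
  have hn : (n : ℝ) + 1 ≠ 0 := by positivity
  have hp : ∀ t : ℕ, K ^ t * L = L := fun t => by
    induction t with
    | zero => simp
    | succ t ih => rw [pow_succ, mul_assoc, h, ih]
  rw [cesaro, smul_mul_assoc, Finset.sum_mul]
  simp only [hp, Finset.sum_const, Finset.card_range, ← Nat.cast_smul_eq_nsmul ℝ, smul_smul]
  push_cast
  rw [one_div_mul_cancel hn, one_smul]

lemma mul_cesaro_eq {L : Matrix S S ℝ} (h : L * K = L) (n : ℕ) : L * cesaro K n = L := by
  have hn : (n : ℝ) + 1 ≠ 0 := by positivity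
  have hp : ∀ t : ℕ, L * K ^ t = L := fun t => by
    induction t with
    | zero => simp
    | succ t ih => rw [pow_succ', ← mul_assoc, h, ih]
  rw [cesaro, mul_smul_comm, Finset.mul_sum]
  simp only [hp, Finset.sum_const, Finset.card_range, ← Nat.cast_smul_eq_nsmul ℝ, smul_smul]
  push_cast
  rw [one_div_mul_cancel hn, one_smul]

/-- The Cesàro limit of the powers of `K`. -/
noncomputable def cesaroLimit (K : Matrix S S ℝ) : Matrix S S ℝ :=
  limUnder atTop (cesaro K)

/-- The Cesàro means of the powers of a stochastic matrix converge. -/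
theorem tendsto_cesaro (hK : K ∈ rowStochastic ℝ S) :
    Tendsto (cesaro K) atTop (𝓝 (cesaroLimit K)) := by
  have : FirstCountableTopology (Matrix S S ℝ) :=
    inferInstanceAs (FirstCountableTopology (S → S → ℝ))
  obtain ⟨s, hc, hmem⟩ : ∃ s : Set (Matrix S S ℝ), IsCompact s ∧ ∀ n, cesaro K n ∈ s :=
    ⟨Set.pi Set.univ fun _ => Set.pi Set.univ fun _ => Set.Icc 0 1,
      isCompact_univ_pi fun _ => isCompact_univ_pi fun _ => isCompact_Icc, fun n x _ y _ =>
      ⟨nonneg_of_mem_rowStochastic (cesaro_mem_rowStochastic hK n),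
        le_one_of_mem_rowStochastic (cesaro_mem_rowStochastic hK n)⟩⟩
  obtain ⟨L, -, φ, hφ, hL⟩ := hc.tendsto_subseq hmem
  refine tendsto_nhds_limUnder ⟨L, tendsto_of_subseq_tendsto fun ns hns => ?_⟩
  obtain ⟨L', -, ms, hms, hL'⟩ := hc.tendsto_subseq fun n => hmem (ns n)
  have h := mul_eq_of_tendsto_subseq hK hφ.tendsto_atTop hL
  have h' := mul_eq_of_tendsto_subseq hK (hns.comp hms.tendsto_atTop) hL'
  -- Both subsequential limits absorb all the means, so `L' * L` equals each of them.
  have e1 : L' * L = L := tendsto_nhds_unique (hL'.mul tendsto_const_nhds)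
    (tendsto_const_nhds.congr fun n => (cesaro_mul_eq h.2 _).symm)
  have e2 : L' * L = L' := tendsto_nhds_unique (tendsto_const_nhds.mul hL)
    (tendsto_const_nhds.congr fun n => (mul_cesaro_eq h'.1 _).symm)
  exact ⟨ms, by rw [← e1, e2]; exact hL'⟩

lemma tendsto_cesaro_apply (hK : K ∈ rowStochastic ℝ S) (x y : S) :
    Tendsto (fun n => cesaro K n x y) atTop (𝓝 (cesaroLimit K x y)) :=
  tendsto_pi_nhds.1 (tendsto_pi_nhds.1 (tendsto_cesaro hK) x) y

/-! ### Invariant measures, accessibility and transience. -/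

/-- A nonnegative row vector that is invariant under the transition matrix `K`. -/
def IsInvariant (K : Matrix S S ℝ) (μ : S → ℝ) : Prop :=
  (∀ s, 0 ≤ μ s) ∧ ∀ s, ∑ x, μ x * K x s = μ s

lemma isInvariant_cesaroLimit (hK : K ∈ rowStochastic ℝ S) (x : S) :
    IsInvariant K (cesaroLimit K x) := by
  refine ⟨fun y => ge_of_tendsto' (tendsto_cesaro_apply hK x y) fun n =>
    nonneg_of_mem_rowStochastic (cesaro_mem_rowStochastic hK n), fun y => ?_⟩
  have h := (mul_eq_of_tendsto_subseq hK tendsto_id (tendsto_cesaro hK)).1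
  exact congrFun (congrFun h x) y

lemma sum_cesaroLimit (hK : K ∈ rowStochastic ℝ S) (x : S) :
    ∑ y, cesaroLimit K x y = 1 := by
  refine tendsto_nhds_unique (tendsto_finsetSum _ fun y _ => tendsto_cesaro_apply hK x y) ?_
  simp only [sum_row_of_mem_rowStochastic (cesaro_mem_rowStochastic hK _) x]
  exact tendsto_const_nhds

lemma IsInvariant.sum_mul_pow {μ : S → ℝ} (h : IsInvariant K μ) (n : ℕ) (s : S) :
    ∑ x, μ x * (K ^ n) x s = μ s := by
  have hv : ∀ n : ℕ, μ ᵥ* K ^ n = μ := fun n => by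
    induction n with
    | zero => simp
    | succ n ih => rw [pow_succ, ← vecMul_vecMul, ih]; exact funext h.2
  exact congrFun (hv n) s

lemma IsInvariant.pos_of_accessible (hK : K ∈ rowStochastic ℝ S) {μ : S → ℝ}
    (h : IsInvariant K μ) {x y : S} (hx : 0 < μ x) (hxy : Accessible K x y) : 0 < μ y := by
  obtain ⟨n, hn⟩ := hxy
  rw [← h.sum_mul_pow n y]
  exact Finset.sum_pos' (fun z _ => mul_nonneg (h.1 z) (pow_mem_Icc hK n z y).1)
    ⟨x, Finset.mem_univ x, mul_pos hx hn⟩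

lemma Accessible.trans (hK : K ∈ rowStochastic ℝ S) {x y z : S} (hxy : Accessible K x y)
    (hyz : Accessible K y z) : Accessible K x z := by
  obtain ⟨n, hn⟩ := hxy
  obtain ⟨m, hm⟩ := hyz
  refine ⟨n + m, ?_⟩
  rw [pow_add, Matrix.mul_apply]
  exact Finset.sum_pos' (fun w _ => mul_nonneg (pow_mem_Icc hK n x w).1 (pow_mem_Icc hK m w z).1)
    ⟨y, Finset.mem_univ y, mul_pos hn hm⟩

lemma Accessible.refl (K : Matrix S S ℝ) (x : S) : Accessible K x x := ⟨0, by simp⟩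

lemma Accessible.of_pos {x y : S} (h : 0 < K x y) : Accessible K x y := ⟨1, by simpa using h⟩

/-- If every transition of `K` out of a state not in `D` is a transition of `K'`, then from a state
with access to `y` under `K` the chain `K'` has access to `y` or to a state in `D`. -/
lemma Accessible.imp_or {K' : Matrix S S ℝ} (hK : K ∈ rowStochastic ℝ S)
    (hK' : K' ∈ rowStochastic ℝ S) {D : Set S}
    (hD : ∀ x ∉ D, ∀ z, 0 < K x z → 0 < K' x z) {x y : S} (h : Accessible K x y) :
    Accessible K' x y ∨ ∃ d ∈ D, Accessible K' x d := by
  obtain ⟨n, hn⟩ := h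
  induction n generalizing x with
  | zero =>
    obtain rfl : x = y := by
      by_contra hne
      simp [Matrix.one_apply_ne hne] at hn
    exact .inl (.refl K' x)
  | succ n ih =>
    by_cases hx : x ∈ D
    · exact .inr ⟨x, hx, .refl K' x⟩
    rw [pow_succ', Matrix.mul_apply] at hn
    obtain ⟨z, -, hz⟩ := Finset.exists_lt_of_sum_lt (s := Finset.univ) (f := fun _ : S => (0 : ℝ))
      (by simpa using hn)
    have hKz : 0 < K x z := lt_of_le_of_ne (nonneg_of_mem_rowStochastic hK) fun h => by
      simp [← h] at hz
    have hz' : Accessible K' x z := .of_pos (hD x hx z hKz)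
    rcases ih (pos_of_mul_pos_right hz hKz.le) with h | ⟨d, hd, h⟩
    · exact .inl (hz'.trans hK' h)
    · exact .inr ⟨d, hd, hz'.trans hK' h⟩

/-- The states accessible from `x` form a nonempty closed subset of `C`, so by minimality all of
`C`. -/
lemma ClosedIrreducible.accessible (hK : K ∈ rowStochastic ℝ S) {C : Set S}
    (hC : ClosedIrreducible K C) {x y : S} (hx : x ∈ C) (hy : y ∈ C) : Accessible K x y := by
  have hR : {z | Accessible K x z} = C :=
    hC.2.2 _ (fun z hz => by_contra fun h => hC.2.1 x hx z h hz) ⟨x, .refl K x⟩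
      fun z hz w hw hzw => hw (Accessible.trans hK hz hzw)
  have : y ∈ {z | Accessible K x z} := hR ▸ hy
  exact this

lemma hitWithin_mem_Icc (hK : K ∈ rowStochastic ℝ S) (s : S) (n : ℕ) (x : S) :
    hitWithin K s n x ∈ Set.Icc (0 : ℝ) 1 := by
  induction n generalizing x with
  | zero => simp [hitWithin]
  | succ n ih =>
    have hn : ∀ y, 0 ≤ K x y := fun y => nonneg_of_mem_rowStochastic hK
    refine ⟨add_nonneg (hn s) (Finset.sum_nonneg fun y _ => mul_nonneg (hn y) (ih y).1), ?_⟩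
    rw [← sum_row_of_mem_rowStochastic hK x, ← Finset.add_sum_erase _ _ (Finset.mem_univ s)]
    exact add_le_add_right
      (Finset.sum_le_sum fun y _ => mul_le_of_le_one_right (hn y) (ih y).2) _

lemma one_sub_hitWithin_succ (hK : K ∈ rowStochastic ℝ S) (s : S) (n : ℕ) (x : S) :
    1 - hitWithin K s (n + 1) x =
      ∑ y ∈ Finset.univ.erase s, K x y * (1 - hitWithin K s n y) := by
  simp only [hitWithin, mul_sub, mul_one, Finset.sum_sub_distrib]
  rw [← sum_row_of_mem_rowStochastic hK x, ← Finset.add_sum_erase _ _ (Finset.mem_univ s)]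
  ring

/-- An invariant measure gives no mass to transient states. -/
theorem IsInvariant.eq_zero_of_transient (hK : K ∈ rowStochastic ℝ S) {μ : S → ℝ}
    (h : IsInvariant K μ) {s : S} (hs : Transient K s) : μ s = 0 := by
  by_contra hne
  have hpos : 0 < μ s := lt_of_le_of_ne (h.1 s) (Ne.symm hne)
  have hδ : 0 < 1 - returnProb K s := sub_pos.2 hs
  have hle : ∀ n, hitWithin K s n s ≤ returnProb K s := fun n =>
    le_ciSup (f := fun n => hitWithin K s n s)
      ⟨1, by rintro _ ⟨n, rfl⟩; exact (hitWithin_mem_Icc hK s n s).2⟩ n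
  -- The `μ`-mass of avoiding `s` for `n` steps drops at each step by at least the fixed amount `μ s
  -- * (1 - returnProb K s)`, yet stays nonnegative.
  have hstep : ∀ n, ∑ x, μ x * (1 - hitWithin K s (n + 1) x) =
      ∑ x, μ x * (1 - hitWithin K s n x) - μ s * (1 - hitWithin K s n s) := fun n => by
    simp only [one_sub_hitWithin_succ hK, Finset.mul_sum]
    rw [Finset.sum_comm, ← Finset.add_sum_erase _ _ (Finset.mem_univ s), add_sub_cancel_left]
    refine Finset.sum_congr rfl fun y _ => ?_
    simp only [← mul_assoc, ← Finset.sum_mul, h.2]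
  have hbound : ∀ n : ℕ, ∑ x, μ x * (1 - hitWithin K s n x) ≤
      ∑ x, μ x - n * (μ s * (1 - returnProb K s)) := fun n => by
    induction n with
    | zero => simp [hitWithin]
    | succ n ih =>
      have := mul_le_mul_of_nonneg_left (sub_le_sub_left (hle n) 1) hpos.le
      rw [hstep]; push_cast; linarith
  obtain ⟨n, hn⟩ := exists_nat_gt ((∑ x, μ x) / (μ s * (1 - returnProb K s)))
  rw [div_lt_iff₀ (mul_pos hpos hδ)] at hn
  have := Finset.sum_nonneg fun x (_ : x ∈ Finset.univ) =>
    mul_nonneg (h.1 x) (sub_nonneg.2 (hitWithin_mem_Icc hK s n x).2)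
  linarith [hbound n]

/-- An invariant measure gives no mass to a state outside `D` that leads to the closed set `D`. -/
lemma IsInvariant.eq_zero_of_accessible_closedSet (hK : K ∈ rowStochastic ℝ S) {μ : S → ℝ}
    (h : IsInvariant K μ) {D : Set S} (hD : ClosedSet K D) {x y : S} (hx : x ∉ D) (hy : y ∈ D)
    (hxy : Accessible K x y) : μ x = 0 := by
  classical
  by_contra hne
  have hpos : 0 < μ x := lt_of_le_of_ne (h.1 x) (Ne.symm hne)
  obtain ⟨n, hn⟩ := hxy
  have hnn := fun x y => (pow_mem_Icc hK n x y).1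
  -- `f z` is the probability of being in `D` after `n` steps. Invariance gives it `μ`-integral
  -- `μ(D)`, which is already attained on `D`, where `f = 1`; nothing is left for `x`.
  let f : S → ℝ := fun z => ∑ w with w ∈ D, (K ^ n) z w
  have hf0 : ∀ z, 0 ≤ f z := fun z => Finset.sum_nonneg fun w _ => hnn z w
  have hf1 : ∀ z ∈ D, f z = 1 := fun z hz => by
    rw [← sum_row_of_mem_rowStochastic (pow_mem hK n) z]
    refine Finset.sum_subset (Finset.filter_subset _ _) fun w _ hw => ?_
    exact le_antisymm (not_lt.1 fun hlt => hD z hz w (by simpa using hw) ⟨n, hlt⟩) (hnn z w)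
  have hfx : 0 < f x := Finset.sum_pos' (fun w _ => hnn x w) ⟨y, by simpa using hy, hn⟩
  have key : ∑ z, μ z * f z = ∑ z with z ∈ D, μ z := by
    simp only [f, Finset.mul_sum]
    rw [Finset.sum_comm]
    exact Finset.sum_congr rfl fun w _ => h.sum_mul_pow n w
  rw [Finset.sum_filter, ← sub_eq_zero, ← Finset.sum_sub_distrib] at key
  refine absurd key (Finset.sum_pos' (fun z _ => ?_) ⟨x, Finset.mem_univ x, ?_⟩).ne'
  · by_cases hz : z ∈ D
    · simp [hz, hf1 z hz]
    · simpa [hz] using mul_nonneg (h.1 z) (hf0 z)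
  · simpa [hx] using mul_pos hpos hfx

/-- Two invariant measures of equal mass, carried by a set of mutually accessible states on which
the second one is positive, coincide. -/
theorem IsInvariant.eq_of_accessible (hK : K ∈ rowStochastic ℝ S) {μ ν : S → ℝ}
    (hμ : IsInvariant K μ) (hν : IsInvariant K ν) (hsum : ∑ x, μ x = ∑ x, ν x) {D : Set S}
    (hacc : ∀ x ∈ D, ∀ y ∈ D, Accessible K x y) (hμD : ∀ x ∉ D, μ x = 0)
    (hνD : ∀ x ∉ D, ν x = 0) (hpos : ∀ x ∈ D, 0 < ν x) : μ = ν := by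
  classical
  rcases D.eq_empty_or_nonempty with rfl | ⟨d, hd⟩
  · exact funext fun x => by rw [hμD x (by simp), hνD x (by simp)]
  obtain ⟨x₀, hx₀, hmin⟩ := Finset.exists_min_image ({x | x ∈ D} : Finset S)
    (fun x => μ x / ν x) ⟨d, by simpa using hd⟩
  simp only [Finset.mem_filter, Finset.mem_univ, true_and] at hx₀ hmin
  set c := μ x₀ / ν x₀ with hc
  -- Since `c` is the minimal ratio, `μ - c ν` is nonnegative and vanishes at `x₀`; any mass
  -- elsewhere in `D` would flow to `x₀`.
  have hρ : IsInvariant K fun x => μ x - c * ν x := by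
    refine ⟨fun x => ?_, fun x => ?_⟩
    · by_cases hx : x ∈ D
      · exact sub_nonneg.2 ((le_div_iff₀ (hpos x hx)).1 (hmin x hx))
      · simp [hμD x hx, hνD x hx]
    · simp only [sub_mul, Finset.sum_sub_distrib, mul_assoc, ← Finset.mul_sum, hμ.2, hν.2]
  have hρ₀ : μ x₀ - c * ν x₀ = 0 := by
    rw [hc, div_mul_cancel₀ _ (hpos x₀ hx₀).ne', sub_self]
  have hprop : ∀ x, μ x = c * ν x := fun x => by
    by_cases hx : x ∈ D
    · by_contra hne
      exact (hρ.pos_of_accessible hK (lt_of_le_of_ne (hρ.1 x) (Ne.symm (sub_ne_zero.2 hne)))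
        (hacc x hx x₀ hx₀)).ne' hρ₀
    · simp [hμD x hx, hνD x hx]
  have hνsum : 0 < ∑ x, ν x := Finset.sum_pos' (fun x _ => hν.1 x) ⟨d, Finset.mem_univ d, hpos d hd⟩
  have hc1 : c = 1 := by
    simp only [hprop, ← Finset.mul_sum] at hsum
    exact (mul_eq_right₀ hνsum.ne').1 hsum
  exact funext fun x => by rw [hprop, hc1, one_mul]

end MarkovChain

/-! ### Prolonging segments at relative interior points. -/

lemma exists_lineMap_mem_of_mem_intrinsicInterior {E : Type*} [NormedAddCommGroup E]
    [NormedSpace ℝ E] {s : Set E} {p q : E} (hq : q ∈ intrinsicInterior ℝ s) (hp : p ∈ s) :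
    ∃ t : ℝ, 1 < t ∧ AffineMap.lineMap p q t ∈ s := by
  obtain ⟨y, hy, rfl⟩ := mem_intrinsicInterior.1 hq
  let f : ℝ → affineSpan ℝ s := fun t =>
    ⟨AffineMap.lineMap p (y : E) t, AffineMap.lineMap_mem t (subset_affineSpan ℝ s hp) y.2⟩
  have hf : Continuous f := AffineMap.lineMap_continuous.subtype_mk _
  have hf1 : f 1 = y := Subtype.ext (AffineMap.lineMap_apply_one _ _)
  have hev : ∀ᶠ t in 𝓝 (1 : ℝ), f t ∈ (Subtype.val ⁻¹' s : Set (affineSpan ℝ s)) :=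
    hf.continuousAt.eventually_mem (by rw [hf1]; exact mem_interior_iff_mem_nhds.1 hy)
  obtain ⟨t, ht, h1⟩ := ((hev.filter_mono nhdsWithin_le_nhds).and
    (self_mem_nhdsWithin : Set.Ioi (1 : ℝ) ∈ 𝓝[>] 1)).exists
  exact ⟨t, h1, ht⟩

namespace MDP

open MarkovChain Matrix

variable {S A : Type*} [Fintype S] [Fintype A]

/-! ### Trajectory laws and the formula for the occupation measure. -/

section Transition

variable [DecidableEq S] (M : MDP S A) (π : StationaryPolicy S A)

lemma transition_mem_rowStochastic : M.transition π ∈ rowStochastic ℝ S := by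
  rw [mem_rowStochastic_iff_sum]
  refine ⟨fun s s' => Finset.sum_nonneg fun a _ =>
    mul_nonneg ((π.prob_mem s).1 a) ((M.P_mem s a).1 s'), fun s => ?_⟩
  simp only [transition]
  rw [Finset.sum_comm]
  simp only [← Finset.mul_sum, (M.P_mem s _).2, mul_one, (π.prob_mem s).2]

lemma trajProb_snoc (s₁ : S) (n : ℕ) (τ : Fin (n + 1) → S × A) (y : S × A) :
    M.trajProb π s₁ (n + 1) (Fin.snoc (α := fun _ => S × A) τ y) =
      M.trajProb π s₁ n τ *
        (M.P (τ (Fin.last n)).1 (τ (Fin.last n)).2 y.1 * π.prob y.1 y.2) := by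
  have h0 : Fin.snoc (α := fun _ => S × A) τ y 0 = τ 0 := Fin.snoc_castSucc (i := 0) ..
  simp only [trajProb, Fin.prod_univ_castSucc, Fin.succ_castSucc, Fin.snoc_castSucc,
    Fin.succ_last, Fin.snoc_last, h0, mul_assoc]

lemma sum_snoc {X : Type*} [Fintype X] (n : ℕ) (f : (Fin (n + 1) → X) → ℝ) :
    ∑ τ, f τ = ∑ τ : Fin n → X, ∑ y, f (Fin.snoc (α := fun _ => X) τ y) := by
  rw [← (Fin.snocEquiv fun _ => X).sum_comp, Fintype.sum_prod_type, Finset.sum_comm]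
  rfl

variable [DecidableEq A]

/-- The law of the state-action pair at a given time. -/
lemma sum_trajProb_mul_ite (s₁ : S) (n : ℕ) (t : Fin (n + 1)) (x : S × A) :
    ∑ τ, M.trajProb π s₁ n τ * (if τ t = x then 1 else 0) =
      (M.transition π ^ (t : ℕ)) s₁ x.1 * π.prob x.1 x.2 := by
  induction n generalizing x with
  | zero =>
    obtain rfl : t = 0 := Fin.fin_one_eq_zero t
    rw [← (Equiv.funUnique (Fin 1) (S × A)).symm.sum_comp]
    simp [trajProb, Matrix.one_apply, eq_comm]
  | succ n ih =>
    rw [sum_snoc]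
    simp only [trajProb_snoc]
    refine Fin.lastCases ?_ (fun t => ?_) t
    · simp only [Fin.snoc_last, mul_ite, mul_one, mul_zero, Finset.sum_ite_eq', Finset.mem_univ,
        if_true, Fin.val_last]
      -- Condition on the penultimate pair `z`, so that the induction hypothesis applies at the last
      -- time.
      have hsplit : ∀ τ : Fin (n + 1) → S × A, M.trajProb π s₁ n τ *
          (M.P (τ (Fin.last n)).1 (τ (Fin.last n)).2 x.1 * π.prob x.1 x.2) =
          ∑ z, M.trajProb π s₁ n τ * (if τ (Fin.last n) = z then 1 else 0) *
            (M.P z.1 z.2 x.1 * π.prob x.1 x.2) := fun τ => by simp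
      simp only [hsplit]
      rw [Finset.sum_comm]
      simp only [← Finset.sum_mul, ih, Fin.val_last]
      rw [pow_succ, Matrix.mul_apply, Fintype.sum_prod_type, Finset.sum_mul]
      refine Finset.sum_congr rfl fun s _ => ?_
      rw [transition, Finset.mul_sum, Finset.sum_mul]
      exact Finset.sum_congr rfl fun a _ => by ring
    · simp only [Fin.snoc_castSucc, Fin.val_castSucc]
      rw [← ih t x]
      refine Finset.sum_congr rfl fun τ _ => ?_
      rw [← Finset.sum_mul, ← Finset.mul_sum, Fintype.sum_prod_type]
      simp only [← Finset.mul_sum, (π.prob_mem _).2, mul_one, (M.P_mem _ _).2]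

lemma meanFrequency_eq (s₁ : S) (n : ℕ) (x : S × A) :
    M.meanFrequency π s₁ n x = cesaro (M.transition π) n s₁ x.1 * π.prob x.1 x.2 := by
  have hsum : ∑ τ, M.trajProb π s₁ n τ * ∑ t : Fin (n + 1), (if τ t = x then 1 else 0) =
      ∑ t : Fin (n + 1), (M.transition π ^ (t : ℕ)) s₁ x.1 * π.prob x.1 x.2 := by
    simp only [Finset.mul_sum]
    rw [Finset.sum_comm]
    simp only [sum_trajProb_mul_ite]
  rw [meanFrequency, hsum, cesaro, Matrix.smul_apply, Matrix.sum_apply, smul_eq_mul]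
  rw [← Finset.sum_mul, Fin.sum_univ_eq_sum_range
    (fun t => (M.transition π ^ t) s₁ x.1) (n + 1), mul_assoc]

lemma tendsto_meanFrequency (s₁ : S) (x : S × A) :
    Tendsto (fun n => M.meanFrequency π s₁ n x) atTop
      (𝓝 (cesaroLimit (M.transition π) s₁ x.1 * π.prob x.1 x.2)) := by
  simp only [meanFrequency_eq]
  exact (tendsto_cesaro_apply (M.transition_mem_rowStochastic π) s₁ x.1).mul_const _

lemma occupationMeasure_apply (s₁ : S) (x : S × A) :
    M.occupationMeasure π s₁ x =
      cesaroLimit (M.transition π) s₁ x.1 * π.prob x.1 x.2 :=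
  (M.tendsto_meanFrequency π s₁ x).limUnder_eq

end Transition

/-! ### The polytope and its achievable points. -/

section Polytope

variable {M : MDP S A} {π : StationaryPolicy S A} {q : S × A → ℝ}

lemma mul_prob_mem_stationaryPolytope {μ : S → ℝ} (hμ : IsInvariant (M.transition π) μ)
    (hsum : ∑ s, μ s = 1) : (fun x => μ x.1 * π.prob x.1 x.2) ∈ M.stationaryPolytope := by
  refine ⟨?_, fun x => mul_nonneg (hμ.1 _) ((π.prob_mem _).1 _), fun s => ?_⟩
  · simp only [Fintype.sum_prod_type, ← Finset.mul_sum, (π.prob_mem _).2, mul_one, hsum]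
  · dsimp only
    rw [← Finset.mul_sum, (π.prob_mem _).2, mul_one, ← hμ.2 s, Fintype.sum_prod_type]
    simp only [transition, Finset.mul_sum, mul_assoc]

lemma isInvariant_marginal (hq : q ∈ M.stationaryPolytope)
    (hπ : ∀ s a, q (s, a) = (∑ b, q (s, b)) * π.prob s a) :
    IsInvariant (M.transition π) fun s => ∑ a, q (s, a) := by
  refine ⟨fun s => Finset.sum_nonneg fun a _ => hq.2.1 _, fun s => ?_⟩
  dsimp only
  rw [hq.2.2 s, Fintype.sum_prod_type]
  refine Finset.sum_congr rfl fun x _ => ?_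
  rw [transition, Finset.mul_sum]
  exact Finset.sum_congr rfl fun a _ => by rw [← mul_assoc, ← hπ]

/-- The policy that disintegrates `q` over its state marginal, and follows `π` in the states of
marginal zero. -/
lemma exists_policy_of_mem_stationaryPolytope (hq : q ∈ M.stationaryPolytope)
    (π : StationaryPolicy S A) : ∃ ρ : StationaryPolicy S A,
      (∀ s a, q (s, a) = (∑ b, q (s, b)) * ρ.prob s a) ∧
      ∀ s, ∑ b, q (s, b) = 0 → ρ.prob s = π.prob s := by
  classical
  refine ⟨⟨fun s => if ∑ b, q (s, b) = 0 then π.prob s else fun a => q (s, a) / ∑ b, q (s, b),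
    fun s => ?_⟩, fun s a => ?_, fun s hs => if_pos hs⟩
  · split_ifs with h
    · exact π.prob_mem s
    · exact ⟨fun a => div_nonneg (hq.2.1 _) (Finset.sum_nonneg fun b _ => hq.2.1 _),
        by rw [← Finset.sum_div, div_self h]⟩
  · dsimp only
    split_ifs with h
    · rw [h, zero_mul]
      exact (Finset.sum_eq_zero_iff_of_nonneg fun b _ => hq.2.1 (s, b)).1 h a (Finset.mem_univ a)
    · rw [mul_div_cancel₀ _ h]

/-- An extreme point of the polytope is determined by its support. -/
lemma eq_of_mem_extremePoints {p : S × A → ℝ}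
    (hq : q ∈ Set.extremePoints ℝ M.stationaryPolytope) (hp : p ∈ M.stationaryPolytope)
    (h : ∀ x, q x = 0 → p x = 0) : p = q := by
  have hqm := hq.1
  have hev : ∀ᶠ ε : ℝ in 𝓝[>] 0, ∀ x, ε * p x ≤ q x := by
    refine eventually_all.2 fun x => ?_
    rcases (hqm.2.1 x).eq_or_lt with h0 | h0
    · simp [h x h0.symm, ← h0]
    · have ht : Tendsto (fun ε : ℝ => ε * p x) (𝓝 0) (𝓝 0) := by
        simpa using (tendsto_id (α := ℝ) (x := 𝓝 0)).mul_const (p x)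
      exact ((ht.eventually_lt_const h0).filter_mono nhdsWithin_le_nhds).mono fun _ => le_of_lt
  obtain ⟨ε, hle, hε⟩ := (hev.and (Ioo_mem_nhdsGT (zero_lt_one' ℝ))).exists
  have h1 : 1 - ε ≠ 0 := (sub_pos.2 hε.2).ne'
  -- For small `ε` the point `q` is the proper convex combination `ε p + (1 - ε) r` inside the
  -- polytope.
  let r : S × A → ℝ := fun x => (q x - ε * p x) / (1 - ε)
  have hr : r ∈ M.stationaryPolytope := by
    refine ⟨?_, fun x => div_nonneg (sub_nonneg.2 (hle x)) (sub_pos.2 hε.2).le, fun s => ?_⟩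
    · simp only [r]
      rw [← Finset.sum_div, Finset.sum_sub_distrib, ← Finset.mul_sum, hqm.1, hp.1, mul_one,
        div_self h1]
    · simp only [r, div_mul_eq_mul_div, sub_mul, mul_assoc]
      rw [← Finset.sum_div, ← Finset.sum_div, Finset.sum_sub_distrib, Finset.sum_sub_distrib,
        ← Finset.mul_sum, ← Finset.mul_sum, hqm.2.2, hp.2.2]
  refine hq.2 hp hr ⟨ε, 1 - ε, hε.1, sub_pos.2 hε.2, by ring, funext fun x => ?_⟩
  simp only [r, Pi.add_apply, Pi.smul_apply, smul_eq_mul]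
  field_simp
  ring

/-- A point in the relative interior of the polytope has the largest support. -/
lemma eq_zero_of_mem_intrinsicInterior {p : S × A → ℝ}
    (hq : q ∈ intrinsicInterior ℝ M.stationaryPolytope) (hp : p ∈ M.stationaryPolytope)
    {x : S × A} (h : q x = 0) : p x = 0 := by
  -- Beyond `q` on the line from `p`, the coordinate at `x` is `(1 - t) * p x` with `t > 1`, so
  -- nonnegativity leaves only `p x = 0`.
  obtain ⟨t, ht, hm⟩ := exists_lineMap_mem_of_mem_intrinsicInterior hq hp
  have := hm.2.1 x
  simp only [AffineMap.lineMap_apply_module, Pi.add_apply, Pi.smul_apply, smul_eq_mul, h] at this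
  refine le_antisymm ?_ (hp.2.1 x)
  by_contra! hlt
  nlinarith

variable [DecidableEq S]

lemma occupationMeasure_mem_stationaryPolytope [DecidableEq A] (π : StationaryPolicy S A)
    (s₁ : S) : M.occupationMeasure π s₁ ∈ M.stationaryPolytope := by
  have hK := M.transition_mem_rowStochastic π
  rw [funext (M.occupationMeasure_apply π s₁)]
  exact mul_prob_mem_stationaryPolytope (isInvariant_cesaroLimit hK s₁) (sum_cesaroLimit hK s₁)

/-- Transience under every policy is applied to the policy that disintegrates `q`. -/
lemma marginal_eq_zero_of_transient (hq : q ∈ M.stationaryPolytope) {s : S}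
    (hs : ∀ π : StationaryPolicy S A, Transient (M.transition π) s)
    (π₀ : StationaryPolicy S A) : ∑ a, q (s, a) = 0 := by
  obtain ⟨π, hπ, -⟩ := exists_policy_of_mem_stationaryPolytope hq π₀
  exact (isInvariant_marginal hq hπ).eq_zero_of_transient
    (M.transition_mem_rowStochastic π) (hs π)

theorem extremePoints_subset_achievable [DecidableEq A] (hM : M.WeaklyCommunicating) (s₁ : S) :
    Set.extremePoints ℝ M.stationaryPolytope ⊆ M.achievableOccupationMeasures s₁ := by
  intro q hqe
  obtain ⟨π₀, C, hC, -, htr⟩ := hM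
  have hq := hqe.1
  obtain ⟨π, hπ, hπ₀⟩ := exists_policy_of_mem_stationaryPolytope hq π₀
  have hK₀ := M.transition_mem_rowStochastic π₀
  have hK := M.transition_mem_rowStochastic π
  have hm := isInvariant_marginal hq hπ
  have hL := isInvariant_cesaroLimit hK s₁
  let D : Set S := {s | 0 < ∑ a, q (s, a)}
  have hD : ClosedSet (M.transition π) D := fun s hs s' hs' hacc =>
    hs' (hm.pos_of_accessible hK hs hacc)
  obtain ⟨d, hd⟩ : D.Nonempty := by
    obtain ⟨d, -, hd⟩ := Finset.exists_lt_of_sum_lt (s := Finset.univ)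
      (f := fun _ : S => (0 : ℝ)) (g := fun s => ∑ a, q (s, a))
      (by simp [← Fintype.sum_prod_type, hq.1])
    exact ⟨d, hd⟩
  have hDC : ∀ s ∈ D, s ∈ C := fun s hs => by_contra fun h =>
    (show 0 < ∑ a, q (s, a) from hs).ne' (marginal_eq_zero_of_transient hq (htr s h) π₀)
  have hLD : ∀ s ∉ D, cesaroLimit (M.transition π) s₁ s = 0 := fun s hs => by
    by_cases hsC : s ∈ C
    -- Off `D` the policies `π` and `π₀` agree, so a `π₀`-path inside `C` towards `d` can be
    -- followed under `π` until it enters `D`.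
    · have hacc : ∃ d ∈ D, Accessible (M.transition π) s d := by
        refine ((hC.accessible hK₀ hsC (hDC d hd)).imp_or hK₀ hK (D := D)
          fun x hx z hz => ?_).elim (fun h => ⟨d, hd, h⟩) id
        have hx0 : ∑ a, q (x, a) = 0 := le_antisymm (not_lt.1 hx) (hm.1 x)
        simpa only [transition, hπ₀ x hx0] using hz
      obtain ⟨e, he, hse⟩ := hacc
      exact hL.eq_zero_of_accessible_closedSet hK hD hs he hse
    · exact hL.eq_zero_of_transient hK (htr s hsC π)
  refine ⟨π, eq_of_mem_extremePoints hqe (occupationMeasure_mem_stationaryPolytope π s₁) ?_⟩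
  rintro ⟨s, a⟩ hx
  dsimp only
  rw [occupationMeasure_apply]
  by_cases hs : s ∈ D
  · rw [hπ, mul_eq_zero] at hx
    rw [hx.resolve_left (ne_of_gt hs), mul_zero]
  · rw [hLD s hs, zero_mul]

theorem intrinsicInterior_subset_achievable [DecidableEq A] (hM : M.WeaklyCommunicating)
    (s₁ : S) :
    intrinsicInterior ℝ M.stationaryPolytope ⊆ M.achievableOccupationMeasures s₁ := by
  intro q hqi
  obtain ⟨π₀, C, hC, -, htr⟩ := hM
  have hq := intrinsicInterior_subset hqi
  obtain ⟨π, hπ, -⟩ := exists_policy_of_mem_stationaryPolytope hq π₀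
  have hK₀ := M.transition_mem_rowStochastic π₀
  have hK := M.transition_mem_rowStochastic π
  have hm := isInvariant_marginal hq hπ
  have hL := isInvariant_cesaroLimit hK s₁
  have hmC : ∀ s ∉ C, ∑ a, q (s, a) = 0 := fun s hs =>
    marginal_eq_zero_of_transient hq (htr s hs) π₀
  -- the occupation measure of `π₀` is positive wherever `π₀` may go inside `C`
  have hμ := isInvariant_cesaroLimit hK₀ s₁
  have hμC : ∀ s ∈ C, 0 < cesaroLimit (M.transition π₀) s₁ s := fun s hs => by
    obtain ⟨d, -, hd⟩ := Finset.exists_lt_of_sum_lt (s := Finset.univ)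
      (f := fun _ : S => (0 : ℝ)) (g := cesaroLimit (M.transition π₀) s₁)
      (by simp [sum_cesaroLimit hK₀ s₁])
    have hdC : d ∈ C := by_contra fun h =>
      hd.ne' (hμ.eq_zero_of_transient hK₀ (htr d h π₀))
    exact hμ.pos_of_accessible hK₀ hd (hC.accessible hK₀ hdC hs)
  -- The occupation measure of `π₀` lies in the polytope, so its support is contained in that of
  -- `q`.
  have hqpos : ∀ s ∈ C, ∀ a, 0 < π₀.prob s a → 0 < q (s, a) := fun s hs a ha => by
    refine lt_of_le_of_ne (hq.2.1 _) fun h => ?_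
    have := eq_zero_of_mem_intrinsicInterior hqi
      (mul_prob_mem_stationaryPolytope hμ (sum_cesaroLimit hK₀ s₁)) h.symm
    exact (mul_pos (hμC s hs) ha).ne' this
  have hKpos : ∀ x ∈ C, ∀ z, 0 < M.transition π₀ x z → ∃ a, 0 < π₀.prob x a ∧ 0 < M.P x a z := by
    intro x _ z hz
    obtain ⟨a, -, ha⟩ := Finset.exists_lt_of_sum_lt (s := Finset.univ)
      (f := fun _ : A => (0 : ℝ)) (g := fun a => π₀.prob x a * M.P x a z) (by rw [Finset.sum_const_zero]; exact hz)
    have ha' : 0 < π₀.prob x a := lt_of_le_of_ne ((π₀.prob_mem x).1 a) fun h => by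
      simp [← h] at ha
    exact ⟨a, ha', pos_of_mul_pos_right ha ha'.le⟩
  have hmpos : ∀ s ∈ C, 0 < ∑ a, q (s, a) := fun s hs => by
    obtain ⟨a, -, ha⟩ := Finset.exists_lt_of_sum_lt (s := Finset.univ)
      (f := fun _ : A => (0 : ℝ)) (g := π₀.prob s) (by simp [(π₀.prob_mem s).2])
    exact Finset.sum_pos' (fun a _ => hq.2.1 _) ⟨a, Finset.mem_univ a, hqpos s hs a ha⟩
  have hacc : ∀ x ∈ C, ∀ y ∈ C, Accessible (M.transition π) x y := fun x hx y hy => by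
    -- The alternative of leaving `C` is excluded: the marginal of `q` is invariant, positive at `x`
    -- and zero off `C`.
    refine ((hC.accessible hK₀ hx hy).imp_or hK₀ hK (D := Cᶜ) fun s hs z hz => ?_).resolve_right
      fun ⟨d, hd, h⟩ => (hm.pos_of_accessible hK (hmpos x hx) h).ne' (hmC d hd)
    have hs : s ∈ C := not_not.1 hs
    obtain ⟨a, ha, haz⟩ := hKpos s hs z hz
    have hπa : 0 < π.prob s a :=
      pos_of_mul_pos_right (hπ s a ▸ hqpos s hs a ha) (hmpos s hs).le
    exact Finset.sum_pos' (fun b _ => mul_nonneg ((π.prob_mem s).1 b) ((M.P_mem s b).1 z))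
      ⟨a, Finset.mem_univ a, mul_pos hπa haz⟩
  have heq := hL.eq_of_accessible hK hm
    (by rw [sum_cesaroLimit hK, ← Fintype.sum_prod_type, hq.1]) hacc
    (fun s hs => hL.eq_zero_of_transient hK (htr s hs π)) hmC hmpos
  refine ⟨π, funext fun x => ?_⟩
  dsimp only
  rw [occupationMeasure_apply, heq]
  exact (hπ x.1 x.2).symm

end Polytope

/-! ### A process with a nonconvex set of occupation measures. -/

/-- The decision process in which the action is the next state. -/
noncomputable def chooseNext (S : Type*) [Fintype S] [DecidableEq S] : MDP S S where
  P _ a := Pi.single a 1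
  P_mem _ a := single_mem_stdSimplex ℝ a

section ChooseNext

variable [DecidableEq S]

lemma transition_chooseNext (π : StationaryPolicy S S) :
    (chooseNext S).transition π = π.prob := by
  ext s s'
  simp [transition, chooseNext, Pi.single_apply]

lemma weaklyCommunicating_chooseNext [Nonempty S] : (chooseNext S).WeaklyCommunicating := by
  have hcard : (0 : ℝ) < Fintype.card S := by exact_mod_cast Fintype.card_pos
  let π : StationaryPolicy S S := ⟨fun _ _ => 1 / Fintype.card S, fun _ =>
    ⟨fun _ => by positivity, by simp [hcard.ne']⟩⟩
  have hD : ∀ D : Set S, D.Nonempty → ClosedSet ((chooseNext S).transition π) D →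
      D = Set.univ := fun D ⟨d, hd⟩ hcl => Set.eq_univ_of_forall fun s => by_contra fun hs =>
    hcl d hd s hs (.of_pos (by rw [transition_chooseNext]; exact one_div_pos.2 hcard))
  exact ⟨π, Set.univ, ⟨Set.univ_nonempty, fun _ _ s hs => absurd (Set.mem_univ s) hs,
    fun D _ => hD D⟩, fun D h => hD D h.1 h.2.1, fun s hs => absurd (Set.mem_univ s) hs⟩

/-- Moving to `a` at every step achieves the point mass at `(a, a)`. -/
lemma single_mem_achievable_chooseNext (s₁ a : S) :
    (Pi.single (a, a) 1 : S × S → ℝ) ∈ (chooseNext S).achievableOccupationMeasures s₁ := by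
  let π : StationaryPolicy S S := ⟨fun _ => Pi.single a 1, fun _ => single_mem_stdSimplex ℝ a⟩
  have hK := (chooseNext S).transition_mem_rowStochastic π
  refine ⟨π, funext fun x => ?_⟩
  dsimp only
  -- All rows of the matrix are the point mass at `a`, so one use of invariance determines the
  -- limit.
  rw [occupationMeasure_apply, ← (isInvariant_cesaroLimit hK s₁).2 x.1]
  simp only [transition_chooseNext, π]
  rw [← Finset.sum_mul]
  have := sum_cesaroLimit hK s₁
  rw [transition_chooseNext] at this
  simp only [π] at this
  rw [this]
  by_cases h1 : x.1 = a <;> by_cases h2 : x.2 = a <;> simp [Pi.single_apply, Prod.ext_iff, h1, h2]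

/-- The midpoint of the point masses at `(s, s)` and `(a, a)` is not achievable: positive mass at
`s`, all of it on the action `s`, makes `s` absorbing, so the chain never reaches `a`. -/
lemma not_convex_achievable_chooseNext {s a : S} (h : a ≠ s) :
    ¬ Convex ℝ ((chooseNext S).achievableOccupationMeasures s) := by
  intro hconv
  obtain ⟨π, hπ⟩ := hconv (single_mem_achievable_chooseNext s s)
    (single_mem_achievable_chooseNext s a) (a := 1 / 2) (b := 1 / 2) (by norm_num) (by norm_num)
    (by norm_num)
  have hK := (chooseNext S).transition_mem_rowStochastic π
  have hval : ∀ x y, cesaroLimit ((chooseNext S).transition π) s x * π.prob x y =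
      1 / 2 * (Pi.single (s, s) 1 : S × S → ℝ) (x, y) +
        1 / 2 * (Pi.single (a, a) 1 : S × S → ℝ) (x, y) := fun x y => by
    have := congrFun hπ (x, y)
    dsimp only at this
    rwa [occupationMeasure_apply] at this
  have hss := hval s s
  simp [h.symm] at hss
  have hs0 : ∀ y, y ≠ s → π.prob s y = 0 := fun y hy => by
    have := hval s y
    rw [Pi.single_eq_of_ne (by simp [hy]), Pi.single_eq_of_ne (by simp [h.symm]), mul_zero,
      add_zero, mul_eq_zero] at this
    refine this.resolve_left fun h0 => ?_
    simp [h0] at hss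
  have hpow : ∀ n : ℕ, ((chooseNext S).transition π ^ n) s a = 0 := fun n => by
    induction n with
    | zero => simp [Matrix.one_apply_ne h.symm]
    | succ n ih =>
      rw [pow_succ', Matrix.mul_apply]
      refine Finset.sum_eq_zero fun y _ => ?_
      by_cases hy : y = s
      · rw [hy, ih, mul_zero]
      · rw [transition_chooseNext, hs0 y hy, zero_mul]
  have hlim : cesaroLimit ((chooseNext S).transition π) s a = 0 :=
    tendsto_nhds_unique (tendsto_cesaro_apply hK s a) (tendsto_const_nhds.congr fun n => by
      simp [cesaro, Matrix.sum_apply, hpow])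
  have haa := hval a a
  simp [hlim, h] at haa

end ChooseNext

end MDP

theorem lemma1 :
    (∀ (S : Type*) (A : Type*) [Fintype S] [DecidableEq S] [Fintype A] [DecidableEq A]
      (M : MDP S A) (s₁ : S), M.WeaklyCommunicating →
        (∀ (π : StationaryPolicy S A) (x : S × A),
          Tendsto (fun n : ℕ => M.meanFrequency π s₁ n x) atTop
            (𝓝 (M.occupationMeasure π s₁ x))) ∧
        intrinsicInterior ℝ M.stationaryPolytope ⊆ M.achievableOccupationMeasures s₁ ∧
        Set.extremePoints ℝ M.stationaryPolytope ⊆ M.achievableOccupationMeasures s₁ ∧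
        M.achievableOccupationMeasures s₁ ⊆ M.stationaryPolytope) ∧
    (∃ (n m : ℕ) (M : MDP (Fin n) (Fin m)) (s₁ : Fin n), M.WeaklyCommunicating ∧
      ¬ Convex ℝ (M.achievableOccupationMeasures s₁)) := by
  refine ⟨fun S A _ _ _ _ M s₁ hM => ⟨fun π x => ?_,
    MDP.intrinsicInterior_subset_achievable hM s₁, MDP.extremePoints_subset_achievable hM s₁, ?_⟩,
    2, 2, MDP.chooseNext (Fin 2), 0, MDP.weaklyCommunicating_chooseNext,
    MDP.not_convex_achievable_chooseNext (a := 1) (by decide)⟩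
  · rw [MDP.occupationMeasure_apply]
    exact M.tendsto_meanFrequency π s₁ x
  · rintro _ ⟨π, rfl⟩
    exact MDP.occupationMeasure_mem_stationaryPolytope π s₁
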